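/- Let $k\ge 1$, $d\ge 0$. Let $(\mathcal U,g)$ be a smooth Lorentzian manifold (signature $(-,+,\dots,+)$) of dimension $k+d+1$, let $\Phi:\mathcal U\to\mathbb R$ be smooth with $d\Phi(p)\ne 0$ for all $p\in\Phi^{-1}(0)$, and let $\mathcal M=\Phi^{-1}(0)$ be the resulting embedded hypersurface, equipped with any distance inducing its topology. Let $g^{\mathcal M}$ be the bilinear form that $g$ induces on the tangent spaces of $\mathcal M$, and suppose that its pointwise kernel, the null distribution $\mathcal N_X=\{v\in T_X\mathcal M: g^{\mathcal M}(v,w)=0\ \forall w\in T_X\mathcal M\}$, has constant rank $k$ and is involutive. Let $\mathscr F$ be the foliation of $\mathcal M$ generated by $\mathcal N$, let $\mathcal M_{\mathrm{red}}=\mathcal M/\mathscr F$ be its leaf space with the quotient topology, and let $\pi:\mathcal M\to\mathcal M_{\mathrm{red}}$ be the canonical projection. Suppose that the leaves are compact and that $\mathscr F$ is simple: $\mathcal M_{\mathrm{red}}$ is Hausdorff and carries a smooth structure of dimension $d$ for which $\pi$ is a smooth submersion. Let $\mathcal V$ be a $C^2$ vector field on $\mathcal M$ which preserves $\mathscr F$,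 i.e. $[\mathcal V,W]$ is a section of $\mathcal N$ for every smooth section $W$ of $\mathcal N$, and suppose that the evolution $\dot X=\mathcal V(X)$ defines a continuous semiflow $(\varphi_t)_{t\ge 0}$ on $\mathcal M$. Let $\mathcal A\subset\mathcal M$ be the global attractor: a compact set with $\varphi_t(\mathcal A)=\mathcal A$ for all $t\ge 0$ and $\operatorname{dist}(\varphi_t(X_0),\mathcal A)\to 0$ as $t\to\infty$ for every $X_0\in\mathcal M$. Then $\mathcal A_*=\pi(\mathcal A)$ is compact in $\mathcal M_{\mathrm{red}}$. Moreover, there is a unique vector field $\mathcal V_*$ on $\mathcal M_{\mathrm{red}}$ with $D\pi_X(\mathcal V(X))=\mathcal V_*(\pi(X))$ for all $X\in\mathcal M$; it is of class $C^2$, and it generates a unique continuous semiflow $(\psi_t)_{t\ge 0}$ on $\mathcal M_{\mathrm{red}}$, the reduced semiflow. It satisfies $\psi_t\circ\pi=\pi\circ\varphi_t$, and $\mathcal A_*$ is invariant under it: $\psi_t(\mathcal A_*)=\mathcal A_*$ for all $t\ge 0$. -/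

import Mathlib

open Set Filter Topology
open scoped Manifold ContDiff NNReal ENNReal

namespace NullReduction

/-- A smooth Lorentzian metric on a manifold of dimension `n + 1`: a smooth symmetric
`(0,2)`-tensor field of signature `(-,+,…,+)` at every point. -/
structure LorentzianMetric (n : ℕ) (U : Type*) [TopologicalSpace U]
    [ChartedSpace (EuclideanSpace ℝ (Fin (n + 1))) U] [IsManifold (𝓡 (n + 1)) ∞ U] where
  /-- The bilinear form on each tangent space. -/
  form (p : U) : TangentSpace (𝓡 (n + 1)) p →L[ℝ] TangentSpace (𝓡 (n + 1)) p →L[ℝ] ℝ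
  symm (p : U) (v w : TangentSpace (𝓡 (n + 1)) p) : form p v w = form p w v
  signature (p : U) : ∃ b : Module.Basis (Fin (n + 1)) ℝ (TangentSpace (𝓡 (n + 1)) p),
    ∀ i j, form p (b i) (b j) = if i = j then (if i = 0 then -1 else 1) else 0
  contMDiff : ContMDiff (𝓡 (n + 1))
    ((𝓡 (n + 1)).prod 𝓘(ℝ, EuclideanSpace ℝ (Fin (n + 1)) →L[ℝ]
      EuclideanSpace ℝ (Fin (n + 1)) →L[ℝ] ℝ)) ∞
    (fun p ↦ Bundle.TotalSpace.mk' (EuclideanSpace ℝ (Fin (n + 1)) →L[ℝ]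
      EuclideanSpace ℝ (Fin (n + 1)) →L[ℝ] ℝ)
      (E := fun p : U ↦ TangentSpace (𝓡 (n + 1)) p →L[ℝ] TangentSpace (𝓡 (n + 1)) p →L[ℝ] ℝ)
      p (form p))

section Constraint

variable {n : ℕ} {U : Type*} [TopologicalSpace U]
  [ChartedSpace (EuclideanSpace ℝ (Fin (n + 1))) U] [IsManifold (𝓡 (n + 1)) ∞ U]
  {M : Type*} [TopologicalSpace M] [ChartedSpace (EuclideanSpace ℝ (Fin n)) M]

/-- The bilinear form induced on the tangent spaces of a hypersurface `M` embedded in `U` by `ι`. -/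
noncomputable def inducedForm (g : LorentzianMetric n U) (ι : M → U) (x : M)
    (v w : TangentSpace (𝓡 n) x) : ℝ :=
  g.form (ι x) (mfderiv (𝓡 n) (𝓡 (n + 1)) ι x v) (mfderiv (𝓡 n) (𝓡 (n + 1)) ι x w)

/-- The null distribution: the pointwise kernel of the induced bilinear form. -/
noncomputable def nullDistribution (g : LorentzianMetric n U) (ι : M → U) (x : M) :
    Submodule ℝ (TangentSpace (𝓡 n) x) where
  carrier := {v | ∀ w : TangentSpace (𝓡 n) x, inducedForm g ι x v w = 0}
  add_mem' := by
    intro a b ha hb w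
    have h1 := ha w
    have h2 := hb w
    simp only [inducedForm] at h1 h2 ⊢
    rw [map_add, map_add, add_apply, h1, h2, add_zero]
  zero_mem' := by
    intro w
    simp only [inducedForm, map_zero, zero_apply]
  smul_mem' := by
    intro c a ha w
    have h1 := ha w
    simp only [inducedForm] at h1 ⊢
    rw [map_smul, map_smul, smul_apply, h1, smul_zero]

end Constraint

section Distribution

variable {m : ℕ} {M : Type*} [TopologicalSpace M] [ChartedSpace (EuclideanSpace ℝ (Fin m)) M]

/-- `W` is a vector field of class `C^r`. -/
def IsVectorField [IsManifold (𝓡 m) ∞ M] (r : WithTop ℕ∞)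
    (W : ∀ x : M, TangentSpace (𝓡 m) x) : Prop :=
  ContMDiff (𝓡 m) (𝓡 m).tangent r (fun x ↦ (⟨x, W x⟩ : TangentBundle (𝓡 m) M))

/-- `W` is a smooth section of the distribution `N`. -/
def IsSection [IsManifold (𝓡 m) ∞ M] (N : ∀ x : M, Submodule ℝ (TangentSpace (𝓡 m) x))
    (W : ∀ x : M, TangentSpace (𝓡 m) x) : Prop :=
  IsVectorField ∞ W ∧ ∀ x, W x ∈ N x

/-- The vector field `V` preserves the distribution `N`: for every smooth section `W` of `N`,
the Lie bracket `[V, W]` takes values in `N`. -/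
def Preserves [IsManifold (𝓡 m) ∞ M] (N : ∀ x : M, Submodule ℝ (TangentSpace (𝓡 m) x))
    (V : ∀ x : M, TangentSpace (𝓡 m) x) : Prop :=
  ∀ W : ∀ x : M, TangentSpace (𝓡 m) x, IsSection N W →
    ∀ x, VectorField.mlieBracket (𝓡 m) V W x ∈ N x

/-- The distribution `N` is involutive: the bracket of two smooth sections takes values in `N`. -/
def Involutive [IsManifold (𝓡 m) ∞ M]
    (N : ∀ x : M, Submodule ℝ (TangentSpace (𝓡 m) x)) : Prop :=
  ∀ V : ∀ x : M, TangentSpace (𝓡 m) x, IsSection N V → Preserves N V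

/-- `x` and `y` are the end points of a differentiable curve in `M` all of whose velocities lie
in the distribution `N`. -/
def TangentCurveJoins (N : ∀ x : M, Submodule ℝ (TangentSpace (𝓡 m) x)) (x y : M) : Prop :=
  ∃ (a b : ℝ) (γ : ℝ → M), a ≤ b ∧ γ a = x ∧ γ b = y ∧
    ∀ t ∈ Icc a b, ∃ w ∈ N (γ t),
      HasMFDerivWithinAt 𝓘(ℝ, ℝ) (𝓡 m) γ (Icc a b) t ((1 : ℝ →L[ℝ] ℝ).smulRight w)

/-- Two points lie on the same leaf if a finite chain of curves tangent to `N` joins them. For an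
involutive distribution of constant rank, the classes are its maximal connected integral
manifolds, that is, the leaves of the foliation generated by `N`. -/
def leafSetoid (N : ∀ x : M, Submodule ℝ (TangentSpace (𝓡 m) x)) : Setoid M :=
  Relation.EqvGen.setoid (TangentCurveJoins N)

/-- The leaf through `x`. -/
def leaf (N : ∀ x : M, Submodule ℝ (TangentSpace (𝓡 m) x)) (x : M) : Set M :=
  {y | leafSetoid N x y}

/-- The leaf space `M / ℱ`. -/
def LeafSpace (N : ∀ x : M, Submodule ℝ (TangentSpace (𝓡 m) x)) : Type _ :=
  Quotient (leafSetoid N)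

/-- The leaf space carries the quotient topology. -/
instance (N : ∀ x : M, Submodule ℝ (TangentSpace (𝓡 m) x)) : TopologicalSpace (LeafSpace N) :=
  inferInstanceAs (TopologicalSpace (Quotient (leafSetoid N)))

/-- The canonical projection onto the leaf space. -/
def leafProj (N : ∀ x : M, Submodule ℝ (TangentSpace (𝓡 m) x)) (x : M) : LeafSpace N :=
  Quotient.mk (leafSetoid N) x

/-- The continuous semiflow `φ` is the evolution generated by the vector field `V`: every forward
trajectory solves `Ẋ = V(X)` on `[0, ∞)`. -/
def IsEvolutionOf (φ : Flow ℝ≥0 M) (V : ∀ x : M, TangentSpace (𝓡 m) x) : Prop :=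
  ∀ x : M, IsMIntegralCurveOn (I := 𝓡 m) (fun t : ℝ ↦ φ t.toNNReal x) V (Ici 0)

end Distribution

/-- `A` is a compact set, invariant under the semiflow, which attracts every trajectory. Attraction
is required of single trajectories only, so that attractors in the stronger sense of uniform
attraction of bounded sets are included. -/
structure IsGlobalAttractor {M : Type*} [MetricSpace M] (φ : Flow ℝ≥0 M) (A : Set M) : Prop where
  isCompact : IsCompact A
  invariant : ∀ t : ℝ≥0, φ t '' A = A
  attracts : ∀ x : M, Tendsto (fun t : ℝ≥0 ↦ Metric.infEDist (φ t x) A) atTop (𝓝 0)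

end NullReduction

open NullReduction

/-! The key point is that `Dπ(V)` is constant along the leaves. Let `f` be `π` read in a chart of
the leaf space. If `Z` is a section of the null distribution `N`, then `Zf = 0`, and `[V,Z]f = 0`
because `V` preserves `N`; hence `Z(Vf) = V(Zf) - [V,Z]f = 0`. Constant rank makes every vector of
`N` the value of a smooth section (`exists_isSection_nullDistribution`), so `Vf` has zero derivative
along every curve tangent to `N` (`TangentCurveJoins.mfderiv_apply_eq`), and chains of such curves
make up the leaves.

Thus `Dπ(V)` descends to a field `W` on the leaf space. Near each point `W` is `Dπ ∘ V ∘ σ` for a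
smooth local section `σ` of the submersion, hence `C²`. Projections of trajectories are integral
curves of `W`. Since the leaf space is Hausdorff, forward integral curves are unique
(`isMIntegralCurveOn_Ici_eqOn`), so `π ∘ φ_t` depends only on the leaf. This defines the reduced
semiflow and gives its uniqueness; openness of `π` gives its continuity. Compactness and invariance
of the projected attractor then follow from continuity of `π` and the semiconjugacy. -/

namespace NullReduction

/-! ### Kernels of constant rank have local sections -/

section KernelSections

variable {E : Type*} [NormedAddCommGroup E] [NormedSpace ℝ E] [FiniteDimensional ℝ E]
  {G : Type*} [NormedAddCommGroup G] [NormedSpace ℝ G]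
  {E' H' : Type*} [NormedAddCommGroup E'] [NormedSpace ℝ E'] [TopologicalSpace H']
  {I : ModelWithCorners ℝ E' H'}
  {M : Type*} [TopologicalSpace M] [ChartedSpace H' M] {r : WithTop ℕ∞}

/-- A family of linear maps on a finite-dimensional space is `C^r` if it is so at each vector. -/
lemma contMDiffOn_clm_of_apply {B : M → E →L[ℝ] G} {s : Set M}
    (h : ∀ v, ContMDiffOn I 𝓘(ℝ, G) r (fun x ↦ B x v) s) :
    ContMDiffOn I 𝓘(ℝ, E →L[ℝ] G) r B s := by
  let b := Module.finBasis ℝ E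
  have hB : B = fun x ↦ ∑ i, ContinuousLinearMap.smulRightL ℝ E G
      (LinearMap.toContinuousLinearMap (b.coord i)) (B x (b i)) := by
    ext x v
    conv_lhs => rw [← b.sum_repr v, map_sum]
    simp
  rw [hB]
  refine contMDiffOn_finsetSum fun i _ ↦ ?_
  exact (ContinuousLinearMap.contMDiff _).comp_contMDiffOn (h (b i))

/-- Vectors in the kernel of a smooth family of linear maps of constant rank extend to smooth
local sections of the kernel. -/
lemma exists_contMDiffOn_mem_ker [FiniteDimensional ℝ G] {B : M → E →L[ℝ] G} {s : Set M}
    (hs : IsOpen s) {x₀ : M} (hx₀ : x₀ ∈ s) (hB : ContMDiffOn I 𝓘(ℝ, E →L[ℝ] G) r B s)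
    (hrank : ∀ x ∈ s, Module.finrank ℝ (B x).ker = Module.finrank ℝ (B x₀).ker)
    {v : E} (hv : B x₀ v = 0) :
    ∃ t ⊆ s, IsOpen t ∧ x₀ ∈ t ∧ ∃ w : M → E, ContMDiffOn I 𝓘(ℝ, E) r w t ∧ w x₀ = v ∧
      ∀ x ∈ t, B x (w x) = 0 := by
  obtain ⟨C, hC⟩ := (B x₀).ker.exists_isCompl
  -- the projection to the kernel along a complement, and a left inverse on the complement
  obtain ⟨Q, hQK, hQC⟩ : ∃ Q : E →ₗ[ℝ] E, (∀ u, B x₀ u = 0 → Q u = u) ∧ (∀ u ∈ C, Q u = 0) ∧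
      ∀ u, B x₀ (Q u) = 0 := by
    refine ⟨(B x₀).ker.subtype ∘ₗ (B x₀).ker.projectionOnto C hC, fun u hu ↦ ?_,
      fun u hu ↦ ?_, fun u ↦ ?_⟩
    · exact congrArg Subtype.val (Submodule.projectionOnto_apply_left hC ⟨u, hu⟩)
    · exact congrArg Subtype.val (Submodule.projectionOnto_apply_of_mem_right hC hu)
    · exact ((B x₀).ker.projectionOnto C hC u).2
  obtain ⟨hQC, hQB⟩ := hQC
  have hinj : LinearMap.ker ((B x₀ : E →ₗ[ℝ] G) ∘ₗ C.subtype) = ⊥ := by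
    rw [LinearMap.ker_eq_bot']
    rintro ⟨u, hu⟩ h
    have : u ∈ (B x₀).ker ⊓ C := ⟨h, hu⟩
    rw [hC.inf_eq_bot] at this
    simpa using this
  obtain ⟨A₀, hA₀⟩ := LinearMap.exists_leftInverse_of_injective _ hinj
  let A : G →L[ℝ] E := LinearMap.toContinuousLinearMap (C.subtype ∘ₗ A₀)
  have hAC (z : G) : A z ∈ C := (A₀ z).2
  have hAB (u : E) : A (B x₀ u) + Q u = u := by
    obtain ⟨a, ha, c, hc, rfl⟩ : ∃ a ∈ (B x₀).ker, ∃ c ∈ C, a + c = u := by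
      rw [← Submodule.mem_sup, hC.sup_eq_top]; trivial
    have h1 : A (B x₀ c) = c := by
      have := LinearMap.congr_fun hA₀ ⟨c, hc⟩
      exact congrArg Subtype.val this
    have h2 : B x₀ a = 0 := ha
    simp [h1, h2, hQK a h2, hQC c hc, add_comm]
  -- By `hAB` this is the identity at `x₀`, so it is invertible nearby; the section will be `(T x)⁻¹
  -- v`.
  let T : M → E →L[ℝ] E := fun x ↦ A ∘L B x + LinearMap.toContinuousLinearMap Q
  have hT : ContMDiffOn I 𝓘(ℝ, E →L[ℝ] E) r T s :=
    (((ContinuousLinearMap.compL ℝ E G E A).contMDiff).comp_contMDiffOn hB).add contMDiffOn_const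
  have hT₀ : T x₀ = ContinuousLinearMap.id ℝ E := by
    ext u
    exact hAB u
  have hopen : IsOpen {S : E →L[ℝ] E | S.IsInvertible} := by
    exact ContinuousLinearEquiv.isOpen
  refine ⟨s ∩ T ⁻¹' {S | S.IsInvertible}, inter_subset_left,
    hT.continuousOn.isOpen_inter_preimage hs hopen, ⟨hx₀, ?_⟩, fun x ↦ (T x).inverse v,
    ?_, ?_, ?_⟩
  · rw [mem_preimage, hT₀]
    exact ContinuousLinearMap.isInvertible_equiv (f := ContinuousLinearEquiv.refl ℝ E)
  · intro x hx
    have h1 : ContMDiffWithinAt I 𝓘(ℝ, E →L[ℝ] E) r (fun x ↦ (T x).inverse)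
        (s ∩ T ⁻¹' {S | S.IsInvertible}) x :=
      (hx.2.contDiffAt_map_inverse (n := r)).contMDiffAt.comp_contMDiffWithinAt x
        ((hT x hx.1).mono inter_subset_left)
    exact h1.clm_apply contMDiffWithinAt_const
  · simp only [hT₀]
    simp
  · rintro x ⟨hxs, hx⟩
    -- On the kernel of `A ∘ B x` the injective map `T x` coincides with `Q`, whose values lie in
    -- the kernel of `B x₀`. This bounds the dimension, and constant rank turns the inclusion into
    -- an equality.
    have hle : (B x).ker ≤ (A ∘L B x).ker := by
      intro u hu
      have : B x u = 0 := hu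
      simp [this]
    have hTinj : Function.Injective (T x) := by
      obtain ⟨e, he⟩ := hx
      rw [← he]
      exact e.injective
    have hle2 : Module.finrank ℝ (A ∘L B x).ker ≤ Module.finrank ℝ (B x₀).ker := by
      let q : (A ∘L B x).ker →ₗ[ℝ] (B x₀).ker :=
        (Q ∘ₗ (A ∘L B x).ker.subtype).codRestrict _ fun u ↦ hQB u
      refine LinearMap.finrank_le_finrank_of_injective (f := q) ?_
      rintro ⟨a, ha⟩ ⟨b, hb⟩ hab
      have h0 : Q a = Q b := congrArg Subtype.val hab
      refine Subtype.ext (hTinj ?_)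
      have ha' : A (B x a) = 0 := ha
      have hb' : A (B x b) = 0 := hb
      simp [T, ha', hb', h0]
    have heq := Submodule.eq_of_le_of_finrank_le hle (hle2.trans_eq (hrank x hxs).symm)
    have hTv : T x ((T x).inverse v) = v := hx.self_apply_inverse v
    have : A (B x ((T x).inverse v)) = 0 := by
      have h1 : A (B x ((T x).inverse v)) = v - Q ((T x).inverse v) :=
        eq_sub_of_add_eq hTv
      -- Since `T x` sends the candidate to `v`, this vector is also `v - Q(...)`: it lies in both
      -- complementary subspaces.
      have h2 : A (B x ((T x).inverse v)) ∈ (B x₀).ker ⊓ C := by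
        refine ⟨?_, hAC _⟩
        rw [h1]
        change B x₀ _ = 0
        rw [map_sub, hv, hQB, sub_zero]
      rw [hC.inf_eq_bot] at h2
      simpa using h2
    have h3 : (T x).inverse v ∈ (A ∘L B x).ker := this
    rw [← heq] at h3
    exact h3

end KernelSections

/-! ### Sections of the null distribution -/

section NullSections

variable {n : ℕ} {U : Type*} [TopologicalSpace U]
  [ChartedSpace (EuclideanSpace ℝ (Fin (n + 1))) U] [IsManifold (𝓡 (n + 1)) ∞ U]
  {M : Type*} [TopologicalSpace M] [ChartedSpace (EuclideanSpace ℝ (Fin n)) M]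
  [IsManifold (𝓡 n) ∞ M]

/-- The induced form of two smooth vector fields is smooth. -/
lemma contMDiffOn_inducedForm (g : LorentzianMetric n U) {ι : M → U}
    (hι : ContMDiff (𝓡 n) (𝓡 (n + 1)) ∞ ι) {s : Set M}
    {X Y : ∀ x : M, TangentSpace (𝓡 n) x}
    (hX : ContMDiffOn (𝓡 n) (𝓡 n).tangent ∞ (fun x ↦ (⟨x, X x⟩ : TangentBundle (𝓡 n) M)) s)
    (hY : ContMDiffOn (𝓡 n) (𝓡 n).tangent ∞ (fun x ↦ (⟨x, Y x⟩ : TangentBundle (𝓡 n) M)) s) :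
    ContMDiffOn (𝓡 n) 𝓘(ℝ, ℝ) ∞ (fun x ↦ inducedForm g ι x (X x) (Y x)) s := by
  have hT := hι.contMDiff_tangentMap (m := ∞) le_rfl
  have h1 := hT.comp_contMDiffOn hX
  have h2 := hT.comp_contMDiffOn hY
  have h3 := g.contMDiff.comp_contMDiffOn (hι.contMDiffOn (s := s))
  intro x hx
  have h4 := ContMDiffWithinAt.clm_bundle_apply₂ (n := ∞)
    (F₁ := EuclideanSpace ℝ (Fin (n + 1))) (F₂ := EuclideanSpace ℝ (Fin (n + 1))) (F₃ := ℝ)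
    (E₁ := fun p : U ↦ TangentSpace (𝓡 (n + 1)) p)
    (E₂ := fun p : U ↦ TangentSpace (𝓡 (n + 1)) p) (E₃ := Bundle.Trivial U ℝ)
    (b := ι) (ψ := fun x ↦ g.form (ι x))
    (v := fun x ↦ mfderiv (𝓡 n) (𝓡 (n + 1)) ι x (X x))
    (w := fun x ↦ mfderiv (𝓡 n) (𝓡 (n + 1)) ι x (Y x)) (h3 x hx) (h1 x hx) (h2 x hx)
  rw [Bundle.contMDiffWithinAt_totalSpace] at h4
  exact h4.2

/-- A vector of the null distribution, if this has constant rank, extends to a smooth section. -/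
lemma exists_isSection_nullDistribution [T2Space M] (g : LorentzianMetric n U) {ι : M → U}
    (hι : ContMDiff (𝓡 n) (𝓡 (n + 1)) ∞ ι) {k : ℕ}
    (hrank : ∀ x : M, Module.finrank ℝ (nullDistribution g ι x) = k) (x₀ : M)
    {v : TangentSpace (𝓡 n) x₀} (hv : v ∈ nullDistribution g ι x₀) :
    ∃ W : ∀ x : M, TangentSpace (𝓡 n) x, IsSection (nullDistribution g ι) W ∧ W x₀ = v := by
  let e := trivializationAt (EuclideanSpace ℝ (Fin n)) (TangentSpace (𝓡 n) (M := M)) x₀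
  let L : ∀ x : M, EuclideanSpace ℝ (Fin n) →L[ℝ] TangentSpace (𝓡 n) x := fun x ↦ e.symmL ℝ x
  have hx₀ : x₀ ∈ e.baseSet := FiberBundle.mem_baseSet_trivializationAt' x₀
  have hL {w : M → EuclideanSpace ℝ (Fin n)} {t : Set M} (ht : t ⊆ e.baseSet)
      (hw : ContMDiffOn (𝓡 n) 𝓘(ℝ, EuclideanSpace ℝ (Fin n)) ∞ w t) :
      ContMDiffOn (𝓡 n) (𝓡 n).tangent ∞ (fun x ↦ (⟨x, L x (w x)⟩ : TangentBundle (𝓡 n) M)) t := by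
    intro x hx
    have h (y) (hy : y ∈ t) : (e ⟨y, L y (w y)⟩).2 = w y := by
      have := congrArg Prod.snd (e.apply_mk_symm (ht hy) (w y))
      rwa [← e.symmL_apply (R := ℝ) (ht hy)] at this
    exact (e.contMDiffWithinAt_section t (ht hx)).2 ((hw x hx).congr h (h x hx))
  -- In the trivialization the form is a smooth family of maps from the model space to its dual, and
  -- the null distribution is its kernel.
  let B : M → EuclideanSpace ℝ (Fin n) →L[ℝ] EuclideanSpace ℝ (Fin n) →L[ℝ] ℝ := fun x ↦
    LinearMap.toContinuousLinearMap
      (LinearMap.toContinuousLinearMap.toLinearMap ∘ₗ LinearMap.mk₂ ℝ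
        (fun v w ↦ inducedForm g ι x (L x v) (L x w))
        (fun a b w ↦ by simp [inducedForm]) (fun c a w ↦ by simp [inducedForm])
        (fun a b w ↦ by simp [inducedForm]) (fun c a w ↦ by simp [inducedForm]))
  have hBapp (x v w) : B x v w = inducedForm g ι x (L x v) (L x w) := rfl
  have hB : ContMDiffOn (𝓡 n) 𝓘(ℝ, EuclideanSpace ℝ (Fin n) →L[ℝ] EuclideanSpace ℝ (Fin n) →L[ℝ] ℝ) ∞ B e.baseSet := by
    refine contMDiffOn_clm_of_apply fun v ↦ contMDiffOn_clm_of_apply fun w ↦ ?_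
    simp only [hBapp]
    exact contMDiffOn_inducedForm g hι (hL subset_rfl contMDiffOn_const)
      (hL subset_rfl contMDiffOn_const)
  have hker {x : M} (hx : x ∈ e.baseSet) (u : EuclideanSpace ℝ (Fin n)) :
      B x u = 0 ↔ L x u ∈ nullDistribution g ι x := by
    constructor
    · intro h w
      obtain ⟨w', rfl⟩ : ∃ w', L x w' = w :=
        ⟨e.continuousLinearMapAt ℝ x w, e.symmL_continuousLinearMapAt hx w⟩
      rw [← hBapp, h]; rfl
    · intro h
      ext w
      exact h _
  have hdim {x : M} (hx : x ∈ e.baseSet) : Module.finrank ℝ (B x).ker = k := by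
    rw [← hrank x]
    let f := (e.continuousLinearEquivAt ℝ x hx).symm.toLinearEquiv
    have hf (u) : f u = L x u := congrFun (e.symm_continuousLinearEquivAt_eq (R := ℝ) hx) u
    have hmap : nullDistribution g ι x = (B x).ker.map (f : _ →ₗ[ℝ] TangentSpace (𝓡 n) x) := by
      ext u
      rw [Submodule.mem_map]
      constructor
      · intro hu
        refine ⟨f.symm u, (hker hx _).2 ?_, f.apply_symm_apply u⟩
        rw [← hf, f.apply_symm_apply]
        exact hu
      · rintro ⟨u', hu', rfl⟩
        exact hf u' ▸ (hker hx u').1 hu'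
    rw [hmap]
    exact (LinearEquiv.finrank_map_eq f _).symm
  obtain ⟨v', rfl⟩ : ∃ v', L x₀ v' = v :=
    ⟨e.continuousLinearMapAt ℝ x₀ v, e.symmL_continuousLinearMapAt hx₀ v⟩
  obtain ⟨t, hte, ht, hxt, w, hw, hwx, hwB⟩ := exists_contMDiffOn_mem_ker e.open_baseSet hx₀ hB
    (fun x hx ↦ (hdim hx).trans (hdim hx₀).symm) ((hker hx₀ v').2 hv)
  -- A bump function equal to 1 at `x₀` and supported in `t` makes the local section global.
  obtain ⟨f, hf, -⟩ := (SmoothBumpFunction.nhds_basis_support (I := 𝓡 n)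
    (ht.mem_nhds hxt)).mem_iff.1 (ht.mem_nhds hxt)
  refine ⟨fun x ↦ f x • L x (w x), ⟨?_, fun x ↦ ?_⟩, ?_⟩
  · exact ContMDiffOn.smul_section_of_tsupport (f.contMDiff.contMDiffOn) ht hf (hL hte hw)
  · by_cases hx : x ∈ t
    · exact Submodule.smul_mem _ _ ((hker (hte hx) _).1 (hwB x hx))
    · have : f x = 0 := image_eq_zero_of_notMem_tsupport fun h ↦ hx (hf h)
      simp only [this, zero_smul, Submodule.zero_mem]
  · simp only [f.eq_one, one_smul, hwx]
end NullSections

/-! ### Derivatives along a field and its bracket -/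

section Brackets

/-- If `f` has vanishing derivative along `W` and along `[V, W]`, then so has its derivative
along `V`. -/
lemma fderiv_fderiv_apply_eq_zero {E F : Type*} [NormedAddCommGroup E] [NormedSpace ℝ E]
    [NormedAddCommGroup F] [NormedSpace ℝ F] {f : E → F} {V W : E → E} {x : E}
    (hf : ContDiffAt ℝ 2 f x) (hV : DifferentiableAt ℝ V x) (hW : DifferentiableAt ℝ W x)
    (hfW : ∀ᶠ y in 𝓝 x, fderiv ℝ f y (W y) = 0)
    (hbr : fderiv ℝ f x (VectorField.lieBracket ℝ V W x) = 0) :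
    DifferentiableAt ℝ (fun y ↦ fderiv ℝ f y (V y)) x ∧
      fderiv ℝ (fun y ↦ fderiv ℝ f y (V y)) x (W x) = 0 := by
  have hsymm : IsSymmSndFDerivAt ℝ f x := hf.isSymmSndFDerivAt (by simp)
  have hf' : DifferentiableAt ℝ (fderiv ℝ f) x :=
    (hf.fderiv_right (m := 1) le_rfl).differentiableAt one_ne_zero
  refine ⟨hf'.clm_apply hV, ?_⟩
  have h0 : fderiv ℝ (fun y ↦ fderiv ℝ f y (W y)) x = 0 := by
    have : (fun y ↦ fderiv ℝ f y (W y)) =ᶠ[𝓝 x] fun _ ↦ 0 := hfW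
    rw [this.fderiv_eq]
    simp
  -- This reads `f''(V, W) + f'(DW V) = 0`; the goal is `f''(W, V) + f'(DV W) = 0`. The second
  -- derivative is symmetric, and `hbr` equates the first-order terms.
  have h1 := congrArg (fun A : E →L[ℝ] F ↦ A (V x)) h0
  rw [fderiv_clm_apply hf' hW] at h1
  rw [fderiv_clm_apply hf' hV]
  simp only [add_apply, ContinuousLinearMap.comp_apply,
    ContinuousLinearMap.flip_apply, zero_apply] at h1 ⊢
  rw [VectorField.lieBracket, map_sub, sub_eq_zero] at hbr
  rw [← hbr, hsymm.eq (W x) (V x)]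
  exact h1

variable {m : ℕ} {M : Type*} [TopologicalSpace M] [ChartedSpace (EuclideanSpace ℝ (Fin m)) M]
  [IsManifold (𝓡 m) ∞ M]

/-- If `f` has vanishing derivative along `W` and along `[V, W]`, then so has its derivative
along `V`. -/
lemma exists_hasMFDerivAt_mfderiv_apply {F : Type*} [NormedAddCommGroup F] [NormedSpace ℝ F]
    {f : M → F} {V W : ∀ x : M, TangentSpace (𝓡 m) x} {x₀ : M}
    (hf : ContMDiffAt (𝓡 m) 𝓘(ℝ, F) 2 f x₀)
    (hV : MDifferentiableAt (𝓡 m) (𝓡 m).tangent (fun x ↦ (⟨x, V x⟩ : TangentBundle (𝓡 m) M)) x₀)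
    (hW : MDifferentiableAt (𝓡 m) (𝓡 m).tangent (fun x ↦ (⟨x, W x⟩ : TangentBundle (𝓡 m) M)) x₀)
    (hfW : ∀ᶠ x in 𝓝 x₀, (mfderiv (𝓡 m) 𝓘(ℝ, F) f x (W x) : F) = 0)
    (hbr : (mfderiv (𝓡 m) 𝓘(ℝ, F) f x₀ (VectorField.mlieBracket (𝓡 m) V W x₀) : F) = 0) :
    ∃ D : EuclideanSpace ℝ (Fin m) →L[ℝ] F,
      HasMFDerivAt (𝓡 m) 𝓘(ℝ, F) (fun x ↦ (mfderiv (𝓡 m) 𝓘(ℝ, F) f x (V x) : F)) x₀ D ∧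
      D (W x₀) = 0 := by
  have : IsManifold (𝓡 m) 1 M := .of_le (n := ∞) (by simp)
  have : IsManifold (𝓡 m) 2 M := .of_le (n := ∞) (WithTop.coe_le_coe.2 le_top)
  let φ := extChartAt (𝓡 m) x₀
  let y₀ := φ x₀
  have hy₀ : φ.symm y₀ = x₀ := extChartAt_to_inv x₀
  have hrange : range (𝓡 m) = univ := by simp
  -- The field read in the chart at `x₀`. The derivative of this chart at its own centre is the
  -- identity, so values at `x₀` are unchanged.
  let lift (X : ∀ x : M, TangentSpace (𝓡 m) x) : EuclideanSpace ℝ (Fin m) →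
      EuclideanSpace ℝ (Fin m) :=
    VectorField.mpullbackWithin 𝓘(ℝ, EuclideanSpace ℝ (Fin m)) (𝓡 m) φ.symm X (range (𝓡 m))
  have hlift (X : ∀ x : M, TangentSpace (𝓡 m) x) : lift X y₀ = X x₀ := by
    have h (z : M) (hz : z = x₀) : (X z : EuclideanSpace ℝ (Fin m)) = X x₀ := by rw [hz]
    exact (mfderivWithin_extChartAt_symm_inverse_apply (I := 𝓡 m) (x := x₀)
      (X (φ.symm y₀))).trans (h _ hy₀)
  have hlift_diff {X : ∀ x : M, TangentSpace (𝓡 m) x} (hX : MDifferentiableAt (𝓡 m)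
      (𝓡 m).tangent (fun x ↦ (⟨x, X x⟩ : TangentBundle (𝓡 m) M)) x₀) :
      DifferentiableAt ℝ (lift X) y₀ := by
    have := (hX.mdifferentiableWithinAt
      (s := univ)).differentiableWithinAt_mpullbackWithin_vectorField
    rw [preimage_univ, univ_inter] at this
    exact DifferentiableWithinAt.differentiableAt this (by rw [hrange]; exact univ_mem)
  have hf' : ContDiffAt ℝ 2 (f ∘ φ.symm) y₀ := by
    have := (contMDiffAt_iff.1 hf).2
    rwa [hrange, contDiffWithinAt_univ, extChartAt_model_space_eq_id] at this
  have htarget : φ.target ∈ 𝓝 y₀ := extChartAt_target_mem_nhds x₀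
  have hfd : ∀ᶠ x in 𝓝 x₀, MDifferentiableAt (𝓡 m) 𝓘(ℝ, F) f x := by
    filter_upwards [(contMDiffAt_iff_contMDiffAt_nhds (by simp)).1 hf] with x hx
    exact hx.mdifferentiableAt (by simp)
  have htend : Tendsto φ.symm (𝓝 y₀) (𝓝 x₀) := by
    have := continuousAt_extChartAt_symm (I := 𝓡 m) x₀
    rwa [ContinuousAt, hy₀] at this
  have hcomp (X : ∀ x : M, TangentSpace (𝓡 m) x) : ∀ᶠ y in 𝓝 y₀,
      fderiv ℝ (f ∘ φ.symm) y (lift X y) = mfderiv (𝓡 m) 𝓘(ℝ, F) f (φ.symm y) (X (φ.symm y)) := by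
    filter_upwards [htarget, htend.eventually hfd] with y hy hfy
    have h1 := mdifferentiableWithinAt_extChartAt_symm hy
    have h2 := isInvertible_mfderivWithin_extChartAt_symm hy
    simp only [lift, VectorField.mpullbackWithin_apply]
    rw [hrange, mdifferentiableWithinAt_univ] at h1
    rw [hrange, mfderivWithin_univ] at h2 ⊢
    rw [← mfderiv_eq_fderiv, mfderiv_comp y hfy h1]
    exact congrArg _ (h2.self_apply_inverse _)
  have hpt (u : EuclideanSpace ℝ (Fin m)) :
      fderiv ℝ (f ∘ φ.symm) y₀ u = mfderiv (𝓡 m) 𝓘(ℝ, F) f x₀ u := by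
    -- `hcomp` needs no regularity of the field, so any field with value `u` at `x₀` serves.
    have := (hcomp fun _ ↦ u).self_of_nhds
    rw [hy₀] at this
    exact (congrArg (fderiv ℝ (f ∘ φ.symm) y₀) (hlift fun _ ↦ u)).symm.trans this
  have hlie : VectorField.mlieBracket (𝓡 m) V W x₀ =
      VectorField.lieBracket ℝ (lift V) (lift W) y₀ := by
    have h : VectorField.lieBracketWithin ℝ (lift V) (lift W) (φ.symm ⁻¹' univ ∩ range (𝓡 m)) y₀ =
        VectorField.lieBracket ℝ (lift V) (lift W) y₀ := by
      rw [hrange, preimage_univ, univ_inter, VectorField.lieBracketWithin_univ]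
    rw [← h, VectorField.mlieBracket, VectorField.mlieBracketWithin_apply, mfderiv_extChartAt_self]
    exact congrArg (fun A : EuclideanSpace ℝ (Fin m) →L[ℝ] EuclideanSpace ℝ (Fin m) ↦ A _)
      ContinuousLinearMap.inverse_id
  obtain ⟨h1, h2⟩ := fderiv_fderiv_apply_eq_zero hf' (hlift_diff hV) (hlift_diff hW) (by
      filter_upwards [hcomp W, htend.eventually hfW] with y h1 h2
      exact h1.trans h2) (by
      exact ((hpt _).trans (congrArg (mfderiv (𝓡 m) 𝓘(ℝ, F) f x₀) hlie).symm).trans hbr)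
  have hmφ : HasMFDerivAt (𝓡 m) 𝓘(ℝ, EuclideanSpace ℝ (Fin m)) φ x₀
      (ContinuousLinearMap.id ℝ (EuclideanSpace ℝ (Fin m))) := by
    have := (mdifferentiableAt_extChartAt (I := 𝓡 m) (mem_chart_source _ x₀)).hasMFDerivAt
    rwa [mfderiv_extChartAt_self] at this
  have h3 := (h1.hasFDerivAt.hasMFDerivAt).comp x₀ hmφ
  refine ⟨_, h3.congr_of_eventuallyEq ?_, ?_⟩
  · have hsource : φ.source ∈ 𝓝 x₀ := extChartAt_source_mem_nhds x₀
    have htend' : Tendsto φ (𝓝 x₀) (𝓝 y₀) := continuousAt_extChartAt x₀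
    filter_upwards [hsource, htend'.eventually (hcomp V)] with x hx hVx
    rw [φ.left_inv hx] at hVx
    exact hVx.symm
  · rw [← hlift W]
    exact h2
end Brackets

/-! ### Functions and fields constant along the leaves -/

section LeafInvariants

variable {m : ℕ} {M : Type*} [TopologicalSpace M] [ChartedSpace (EuclideanSpace ℝ (Fin m)) M]
  {N : ∀ x : M, Submodule ℝ (TangentSpace (𝓡 m) x)}

/-- The initial point of a curve tangent to `N` is joined to all its points. -/
lemma TangentCurveJoins.restrict {a b : ℝ} {γ : ℝ → M}
    (hγ : ∀ t ∈ Icc a b, ∃ w ∈ N (γ t),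
      HasMFDerivWithinAt 𝓘(ℝ, ℝ) (𝓡 m) γ (Icc a b) t ((1 : ℝ →L[ℝ] ℝ).smulRight w))
    {t : ℝ} (ht : t ∈ Icc a b) : TangentCurveJoins N (γ a) (γ t) :=
  ⟨a, t, γ, ht.1, rfl, rfl, fun s hs ↦ by
    obtain ⟨w, hw, h⟩ := hγ s ⟨hs.1, hs.2.trans ht.2⟩
    exact ⟨w, hw, h.mono (Icc_subset_Icc_right ht.2)⟩⟩

variable [IsManifold (𝓡 m) ∞ M]
  {E H X : Type*} [NormedAddCommGroup E] [NormedSpace ℝ E] [TopologicalSpace H]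
  {I : ModelWithCorners ℝ E H} [TopologicalSpace X] [ChartedSpace H X]

/-- A function which is constant along the curves tangent to `N` has vanishing derivative along
the smooth sections of `N`. -/
lemma IsSection.mfderiv_eq_zero {W : ∀ x : M, TangentSpace (𝓡 m) x} (hW : IsSection N W)
    {f : M → X} (hconst : ∀ x y, TangentCurveJoins N x y → f x = f y) {x : M}
    (hf : MDifferentiableAt (𝓡 m) I f x) : mfderiv (𝓡 m) I f x (W x) = 0 := by
  have : IsManifold (𝓡 m) 1 M := .of_le (n := ∞) (by simp)
  obtain ⟨γ, hγ0, hγ⟩ := exists_isMIntegralCurveAt_of_contMDiffAt_boundaryless 0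
    ((hW.1.of_le (m := 1) (by simp)).contMDiffAt (x := x))
  subst hγ0
  rw [isMIntegralCurveAt_iff'] at hγ
  obtain ⟨ε, hε, hγ⟩ := hγ
  -- `TangentCurveJoins` requires a closed interval, hence the halved radius.
  have hsub : Icc 0 (ε / 2) ⊆ Metric.ball (0 : ℝ) ε := by
    intro t ht
    rw [Metric.mem_ball, dist_zero_right, Real.norm_of_nonneg ht.1]
    linarith [ht.2]
  have hγ' : IsMIntegralCurveOn γ W (Icc 0 (ε / 2)) := hγ.mono hsub
  have h0 : (0 : ℝ) ∈ Icc 0 (ε / 2) := ⟨le_rfl, by positivity⟩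
  have h1 := hf.hasMFDerivAt.comp_hasMFDerivWithinAt 0 (hγ' 0 h0)
  have h2 := HasMFDerivWithinAt.congr_of_eventuallyEq (f₁ := f ∘ γ)
    (hasMFDerivWithinAt_const (I := 𝓘(ℝ, ℝ)) (I' := I) (f (γ 0)) (Icc 0 (ε / 2)) 0)
    (eventually_of_mem self_mem_nhdsWithin fun t ht ↦
      (hconst _ _ (TangentCurveJoins.restrict
        (fun s hs ↦ ⟨W (γ s), hW.2 _, hγ' s hs⟩) ht)).symm) rfl
  have hu : UniqueMDiffWithinAt 𝓘(ℝ, ℝ) (Icc 0 (ε / 2)) 0 :=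
    (uniqueDiffOn_Icc (by positivity) 0 h0).uniqueMDiffWithinAt
  have h3 := hu.eq h1 h2
  have h4 := congrArg (fun A : ℝ →L[ℝ] E ↦ A 1) h3
  have h5 : (1 : ℝ →L[ℝ] ℝ).smulRight (W (γ 0)) (1 : ℝ) = W (γ 0) := one_smul ℝ _
  exact (congrArg (mfderiv (𝓡 m) I f (γ 0)) h5).symm.trans h4

variable {d : ℕ} {Y : Type*} [TopologicalSpace Y] [ChartedSpace (EuclideanSpace ℝ (Fin d)) Y]
  [IsManifold (𝓡 d) ∞ Y]

/-- Let `f` be constant along the curves tangent to `N`, and let `V` preserve `N`. Then the image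
of `V` under the derivative of `f` is constant along these curves. -/
lemma TangentCurveJoins.mfderiv_apply_eq {V : ∀ x : M, TangentSpace (𝓡 m) x}
    (hext : ∀ x, ∀ v ∈ N x, ∃ W : ∀ x : M, TangentSpace (𝓡 m) x, IsSection N W ∧ W x = v)
    (hV : IsVectorField 2 V) (hpres : Preserves N V)
    {f : M → Y} (hf : ContMDiff (𝓡 m) (𝓡 d) ∞ f)
    (hconst : ∀ x y, TangentCurveJoins N x y → f x = f y) {x y : M}
    (hxy : TangentCurveJoins N x y) :
    (mfderiv (𝓡 m) (𝓡 d) f x (V x) : EuclideanSpace ℝ (Fin d)) =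
      mfderiv (𝓡 m) (𝓡 d) f y (V y) := by
  have : IsManifold (𝓡 m) 1 M := .of_le (n := ∞) (by simp)
  have : IsManifold (𝓡 d) 1 Y := .of_le (n := ∞) (by simp)
  obtain ⟨a, b, γ, hab, rfl, rfl, hγ⟩ := hxy
  let φ := extChartAt (𝓡 d) (f (γ a))
  let h : M → EuclideanSpace ℝ (Fin d) := fun z ↦ φ (f z)
  let F : M → EuclideanSpace ℝ (Fin d) := fun z ↦
    mfderiv (𝓡 m) 𝓘(ℝ, EuclideanSpace ℝ (Fin d)) h z (V z)
  have hsource : IsOpen (f ⁻¹' φ.source) := (isOpen_extChartAt_source _).preimage hf.continuous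
  have hh (z : M) (hz : z ∈ f ⁻¹' φ.source) :
      ContMDiffAt (𝓡 m) 𝓘(ℝ, EuclideanSpace ℝ (Fin d)) ∞ h z := by
    rw [mem_preimage, extChartAt_source] at hz
    exact (contMDiffAt_extChartAt' hz).comp z (hf z)
  have hhd (z : M) (hz : z ∈ f ⁻¹' φ.source) := (hh z hz).mdifferentiableAt (by simp)
  have hhconst (x y) (hxy : TangentCurveJoins N x y) : h x = h y :=
    congrArg φ (hconst x y hxy)
  -- On this fibre the chart is taken at its centre, where its derivative is the identity; off the
  -- fibre the two sides may differ.
  have hF (z : M) (hz : f z = f (γ a)) : F z = mfderiv (𝓡 m) (𝓡 d) f z (V z) := by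
    have h1 : HasMFDerivAt (𝓡 d) 𝓘(ℝ, EuclideanSpace ℝ (Fin d)) φ (f z)
        (ContinuousLinearMap.id ℝ (EuclideanSpace ℝ (Fin d))) := by
      have := (mdifferentiableAt_extChartAt (I := 𝓡 d)
        (mem_chart_source _ (f (γ a)))).hasMFDerivAt
      rw [mfderiv_extChartAt_self] at this
      rw [hz]
      exact this
    have h2 := (h1.comp z (hf.mdifferentiableAt (by simp)).hasMFDerivAt).mfderiv
    exact congrArg (fun A : EuclideanSpace ℝ (Fin m) →L[ℝ] EuclideanSpace ℝ (Fin d) ↦ A (V z)) h2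
  have hγf (t : ℝ) (ht : t ∈ Icc a b) : f (γ t) = f (γ a) :=
    (hconst _ _ (TangentCurveJoins.restrict hγ ht)).symm
  have hderiv (t : ℝ) (ht : t ∈ Icc a b) : HasDerivWithinAt (F ∘ γ) 0 (Icc a b) t := by
    obtain ⟨w, hw, hγt⟩ := hγ t ht
    obtain ⟨W, hW, rfl⟩ := hext _ w hw
    have hmem : γ t ∈ f ⁻¹' φ.source := by
      rw [mem_preimage, hγf t ht]
      exact mem_extChartAt_source _
    obtain ⟨D, hD, hDW⟩ := exists_hasMFDerivAt_mfderiv_apply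
      ((hh _ hmem).of_le (m := 2) (WithTop.coe_le_coe.2 le_top))
      ((hV (γ t)).mdifferentiableAt (by simp)) ((hW.1 (γ t)).mdifferentiableAt (by simp))
      (by
        filter_upwards [hsource.mem_nhds hmem] with z hz
        exact hW.mfderiv_eq_zero hhconst (hhd z hz))
      (by
        -- The bracket need not itself be a smooth section, as `V` is only `C²`; its value at this
        -- one point is extended afresh.
        obtain ⟨Z, hZ, hZt⟩ := hext _ _ (hpres W hW (γ t))
        rw [← hZt]
        exact hZ.mfderiv_eq_zero hhconst (hhd _ hmem))
    have h1 := hD.comp_hasMFDerivWithinAt t hγt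
    have h2 : HasFDerivWithinAt (F ∘ γ) (D ∘L (1 : ℝ →L[ℝ] ℝ).smulRight (W (γ t))) (Icc a b) t :=
      h1.hasFDerivWithinAt
    have h3 : (1 : ℝ →L[ℝ] ℝ).smulRight (W (γ t)) (1 : ℝ) = W (γ t) := one_smul ℝ _
    have h4 : (D ∘L (1 : ℝ →L[ℝ] ℝ).smulRight (W (γ t))) (1 : ℝ) = 0 :=
      (congrArg D h3).trans hDW
    exact h4 ▸ h2.hasDerivWithinAt
  have hFγ := constant_of_has_deriv_right_zero
    (fun t ht ↦ (hderiv t ht).continuousWithinAt)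
    (fun t ht ↦ (hderiv t ⟨ht.1, ht.2.le⟩).mono_of_mem_nhdsWithin
      (Icc_mem_nhdsGE_of_mem ht)) b (right_mem_Icc.2 hab)
  rw [← hF _ rfl, ← hF _ (hγf b (right_mem_Icc.2 hab))]
  exact hFγ.symm

end LeafInvariants

/-! ### Uniqueness of forward integral curves -/

section ForwardUniqueness

variable {E H M : Type*} [NormedAddCommGroup E] [NormedSpace ℝ E] [TopologicalSpace H]
  {I : ModelWithCorners ℝ E H} [TopologicalSpace M] [ChartedSpace H M]

/-- A curve arriving at a point and a curve departing from it form an integral curve. -/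
lemma isMIntegralCurveOn_piecewise {v : ∀ x : M, TangentSpace I x} {β γ : ℝ → M} {ε T : ℝ}
    (hβ : IsMIntegralCurveOn β v (Ioo (-ε) ε)) (hγ : IsMIntegralCurveOn γ v (Ici 0))
    (h0 : β 0 = γ 0) :
    IsMIntegralCurveOn ((Iic 0).piecewise β γ) v (Ioo (-ε) T) := by
  intro t ht
  have hleft (s : ℝ) (hs : s ≤ 0) : (Iic 0).piecewise β γ s = β s :=
    piecewise_eq_of_mem _ _ _ hs
  have hright (s : ℝ) (hs : 0 ≤ s) : (Iic 0).piecewise β γ s = γ s := by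
    rcases hs.eq_or_lt with rfl | hs
    · rw [hleft _ le_rfl, h0]
    · exact piecewise_eq_of_notMem _ _ _ (not_le.2 hs)
  have hε (ht0 : t ≤ 0) : t ∈ Ioo (-ε) ε := ⟨ht.1, by linarith [ht.1]⟩
  have h1 (ht0 : t ≤ 0) : HasMFDerivWithinAt 𝓘(ℝ, ℝ) I ((Iic 0).piecewise β γ) (Iic 0) t
      ((1 : ℝ →L[ℝ] ℝ).smulRight (v ((Iic 0).piecewise β γ t))) := by
    have h := ((hβ t (hε ht0)).hasMFDerivAt
      (Ioo_mem_nhds (hε ht0).1 (hε ht0).2)).hasMFDerivWithinAt (s := Iic 0)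
    rw [← hleft t ht0] at h
    exact h.congr_of_eventuallyEq (eventually_of_mem self_mem_nhdsWithin hleft) (hleft t ht0)
  have h2 (ht0 : 0 ≤ t) : HasMFDerivWithinAt 𝓘(ℝ, ℝ) I ((Iic 0).piecewise β γ) (Ici 0) t
      ((1 : ℝ →L[ℝ] ℝ).smulRight (v ((Iic 0).piecewise β γ t))) := by
    have h := hγ t ht0
    rw [← hright t ht0] at h
    exact h.congr_of_eventuallyEq (eventually_of_mem self_mem_nhdsWithin hright) (hright t ht0)
  rcases lt_trichotomy t 0 with ht0 | rfl | ht0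
  · exact ((h1 ht0.le).hasMFDerivAt (Iic_mem_nhds ht0)).hasMFDerivWithinAt
  -- At the junction both one-sided derivatives equal the value of `v` there, so they glue.
  · exact ((h1 le_rfl).union (h2 le_rfl)).mono (by simp)
  · exact ((h2 ht0.le).hasMFDerivAt (Ici_mem_nhds ht0)).hasMFDerivWithinAt

/-- Integral curves of a `C¹` vector field which are defined forward in time are determined by
their initial points. -/
lemma isMIntegralCurveOn_Ici_eqOn [IsManifold I 1 M] [CompleteSpace E] [T2Space M]
    [BoundarylessManifold I M] {v : ∀ x : M, TangentSpace I x} {γ γ' : ℝ → M}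
    (hv : ContMDiff I I.tangent 1 (fun x ↦ (⟨x, v x⟩ : TangentBundle I M)))
    (hγ : IsMIntegralCurveOn γ v (Ici 0)) (hγ' : IsMIntegralCurveOn γ' v (Ici 0))
    (h0 : γ 0 = γ' 0) : EqOn γ γ' (Ici 0) := by
  -- Both curves are prolonged to negative times by the same local solution, so that uniqueness on
  -- an open interval around 0 applies.
  obtain ⟨β, hβ0, hβ⟩ := exists_isMIntegralCurveAt_of_contMDiffAt_boundaryless 0
    (hv.contMDiffAt (x := γ 0))
  rw [isMIntegralCurveAt_iff'] at hβ
  obtain ⟨ε, hε, hβ⟩ := hβ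
  rw [Real.ball_eq_Ioo, zero_sub, zero_add] at hβ
  intro t ht
  rcases (mem_Ici.1 ht).eq_or_lt with rfl | ht'
  · exact h0
  have h := isMIntegralCurveOn_Ioo_eqOn_of_contMDiff_boundaryless
    (a := -ε) (b := t + 1) (t₀ := 0) ⟨by linarith, by linarith⟩ hv
    (isMIntegralCurveOn_piecewise hβ hγ hβ0) (isMIntegralCurveOn_piecewise hβ hγ' (hβ0.trans h0))
    (by simp) (⟨by linarith, by linarith⟩ : t ∈ Ioo (-ε) (t + 1))
  have hnot : t ∉ Iic (0 : ℝ) := not_le.2 ht'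
  rwa [piecewise_eq_of_notMem _ _ _ hnot, piecewise_eq_of_notMem _ _ _ hnot] at h

end ForwardUniqueness

/-! ### Local sections and openness of submersions -/

section Submersions

/-- A submersion of manifolds without boundary has smooth local sections. -/
lemma _root_.Manifold.IsSubmersion.exists_contMDiffAt_section {m d : ℕ} {r : WithTop ℕ∞}
    {M Y : Type*} [TopologicalSpace M] [ChartedSpace (EuclideanSpace ℝ (Fin m)) M]
    [TopologicalSpace Y] [ChartedSpace (EuclideanSpace ℝ (Fin d)) Y]
    {f : M → Y} (hf : Manifold.IsSubmersion (𝓡 m) (𝓡 d) r f) (x : M) :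
    ∃ σ : Y → M, ContMDiffAt (𝓡 d) (𝓡 m) r σ (f x) ∧ σ (f x) = x ∧ ∀ᶠ y in 𝓝 (f x), f (σ y) = y := by
  have h := hf.isSubmersionAt x
  let φ := h.domChart.extend (𝓡 m)
  let ψ := h.codChart.extend (𝓡 d)
  have hxφ : x ∈ φ.source := by
    rw [OpenPartialHomeomorph.extend_source]; exact h.mem_domChart_source
  have hxψ : f x ∈ ψ.source := by
    rw [OpenPartialHomeomorph.extend_source]; exact h.mem_codChart_source
  -- In adapted charts `f` is the first projection; the section freezes the second coordinate at its
  -- value at `x`.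
  let c := (h.equiv (φ x)).2
  let τ : Y → EuclideanSpace ℝ (Fin m) := fun y ↦ h.equiv.symm (ψ y, c)
  have hw (z : EuclideanSpace ℝ (Fin m)) (hz : z ∈ φ.target) :
      ψ (f (φ.symm z)) = (h.equiv z).1 := h.writtenInCharts hz
  have hτx : τ (f x) = φ x := by
    have := hw _ (φ.map_source hxφ)
    rw [φ.left_inv hxφ] at this
    simp only [τ, c]
    rw [this, Prod.mk.eta, ContinuousLinearEquiv.symm_apply_apply]
  have hψ : ContMDiffAt (𝓡 d) 𝓘(ℝ, EuclideanSpace ℝ (Fin d)) r ψ (f x) :=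
    OpenPartialHomeomorph.contMDiffAt_extend h.codChart_mem_maximalAtlas h.mem_codChart_source
  have hτ : ContMDiffAt (𝓡 d) 𝓘(ℝ, EuclideanSpace ℝ (Fin m)) r τ (f x) :=
    (h.equiv.symm.contDiff.contMDiff.contMDiffAt).comp (f x)
      (hψ.prodMk_space contMDiffAt_const)
  have htarget : IsOpen φ.target := h.domChart.isOpen_extend_target
  have hφsymm : ContMDiffAt 𝓘(ℝ, EuclideanSpace ℝ (Fin m)) (𝓡 m) r φ.symm (τ (f x)) := by
    rw [hτx]
    refine (contMDiffOn_extend_symm h.domChart_mem_maximalAtlas).contMDiffAt ?_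
    have : (𝓡 m) '' h.domChart.target = φ.target := by simp [φ, OpenPartialHomeomorph.extend]
    rw [this]
    exact htarget.mem_nhds (φ.map_source hxφ)
  refine ⟨φ.symm ∘ τ, hφsymm.comp (f x) hτ, ?_, ?_⟩
  · rw [Function.comp_apply, hτx, φ.left_inv hxφ]
  · have h1 : ∀ᶠ y in 𝓝 (f x), τ y ∈ φ.target :=
      hτ.continuousAt.eventually (htarget.mem_nhds (by rw [hτx]; exact φ.map_source hxφ))
    have h2 : ∀ᶠ y in 𝓝 (f x), y ∈ ψ.source :=
      (h.codChart.isOpen_extend_source (I := 𝓡 d)).mem_nhds hxψ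
    filter_upwards [h1, h2] with y hy hyψ
    have h3 := hw _ hy
    simp only [τ, ContinuousLinearEquiv.apply_symm_apply] at h3
    have h4 : f (φ.symm (τ y)) ∈ ψ.source := by
      rw [OpenPartialHomeomorph.extend_source]
      apply h.source_subset_preimage_source
      rw [← OpenPartialHomeomorph.extend_source (I := 𝓡 m)]
      exact φ.map_target hy
    exact ψ.injOn h4 hyψ h3

/-- A submersion of manifolds without boundary is an open map. -/
lemma _root_.Manifold.IsSubmersion.isOpenMap {m d : ℕ} {r : WithTop ℕ∞}
    {M Y : Type*} [TopologicalSpace M] [ChartedSpace (EuclideanSpace ℝ (Fin m)) M]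
    [TopologicalSpace Y] [ChartedSpace (EuclideanSpace ℝ (Fin d)) Y]
    {f : M → Y} (hf : Manifold.IsSubmersion (𝓡 m) (𝓡 d) r f) : IsOpenMap f := by
  refine IsOpenMap.of_nhds_le fun x ↦ ?_
  obtain ⟨σ, hσ, hσx, hfσ⟩ := hf.exists_contMDiffAt_section x
  have h : Tendsto σ (𝓝 (f x)) (𝓝 x) := by
    have := hσ.continuousAt.tendsto
    rwa [hσx] at this
  calc 𝓝 (f x) = map (f ∘ σ) (𝓝 (f x)) := by
        rw [map_congr (show f ∘ σ =ᶠ[𝓝 (f x)] id from hfσ), map_id]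
    _ ≤ map f (𝓝 x) := by
        rw [← map_map]
        exact map_mono h

end Submersions

end NullReduction

/-! ### The reduced field, its semiflow and the projected attractor -/

theorem proposition6 {k d : ℕ} (hk : 1 ≤ k)
    -- the ambient Lorentzian phase space, of dimension `k + d + 1`
    {U : Type*} [TopologicalSpace U] [T2Space U] [SecondCountableTopology U]
    [ChartedSpace (EuclideanSpace ℝ (Fin (k + d + 1))) U] [IsManifold (𝓡 (k + d + 1)) ∞ U]
    (g : LorentzianMetric (k + d) U)
    -- the constraint function, with regular zero level
    (Φ : U → ℝ) (hΦ : ContMDiff (𝓡 (k + d + 1)) 𝓘(ℝ, ℝ) ∞ Φ)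
    (hreg : ∀ p, Φ p = 0 → mfderiv (𝓡 (k + d + 1)) 𝓘(ℝ, ℝ) Φ p ≠ 0)
    -- the constraint manifold `Φ⁻¹(0)`, with any metric that induces its topology
    {M : Type*} [MetricSpace M]
    [ChartedSpace (EuclideanSpace ℝ (Fin (k + d))) M] [IsManifold (𝓡 (k + d)) ∞ M]
    (ι : M → U) (hι : Manifold.IsSmoothEmbedding (𝓡 (k + d)) (𝓡 (k + d + 1)) ∞ ι)
    (hιΦ : range ι = Φ ⁻¹' {0})
    -- the null distribution has constant rank `k` and is involutive, with compact leaves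
    (hrank : ∀ x : M, Module.finrank ℝ (nullDistribution g ι x) = k)
    (hinv : Involutive (nullDistribution g ι))
    (hleaf : ∀ x : M, IsCompact (leaf (nullDistribution g ι) x))
    -- the leaf space is Hausdorff, a smooth manifold, and the projection is a submersion
    [T2Space (LeafSpace (nullDistribution g ι))]
    [ChartedSpace (EuclideanSpace ℝ (Fin d)) (LeafSpace (nullDistribution g ι))]
    [IsManifold (𝓡 d) ∞ (LeafSpace (nullDistribution g ι))]
    (hπ : Manifold.IsSubmersion (𝓡 (k + d)) (𝓡 d) ∞
      (leafProj (nullDistribution g ι)))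
    -- the intrinsic vector field, which preserves the null foliation, and its semiflow
    (V : ∀ x : M, TangentSpace (𝓡 (k + d)) x) (hV : IsVectorField 2 V)
    (hpres : Preserves (nullDistribution g ι) V)
    (φ : Flow ℝ≥0 M) (hφ : IsEvolutionOf φ V)
    -- the global attractor
    (A : Set M) (hA : IsGlobalAttractor φ A) :
    -- the projected attractor is compact
    IsCompact (leafProj (nullDistribution g ι) '' A) ∧
    -- there is a unique reduced vector field, and it is of class `C²`
    ∃ W : ∀ y : LeafSpace (nullDistribution g ι), TangentSpace (𝓡 d) y,
      IsVectorField 2 W ∧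
      (∀ x, mfderiv (𝓡 (k + d)) (𝓡 d) (leafProj (nullDistribution g ι)) x (V x)
        = W (leafProj (nullDistribution g ι) x)) ∧
      (∀ W' : ∀ y : LeafSpace (nullDistribution g ι), TangentSpace (𝓡 d) y,
        (∀ x, mfderiv (𝓡 (k + d)) (𝓡 d) (leafProj (nullDistribution g ι)) x (V x)
          = W' (leafProj (nullDistribution g ι) x)) → W' = W) ∧
      -- it generates a unique semiflow, namely the projection of `φ`,
      ∃ ψ : Flow ℝ≥0 (LeafSpace (nullDistribution g ι)),
        IsEvolutionOf ψ W ∧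
        (∀ ψ' : Flow ℝ≥0 (LeafSpace (nullDistribution g ι)),
          IsEvolutionOf ψ' W → ψ' = ψ) ∧
        (∀ (t : ℝ≥0) (x : M), ψ t (leafProj (nullDistribution g ι) x)
          = leafProj (nullDistribution g ι) (φ t x)) ∧
        -- under which the projected attractor is invariant
        ∀ t : ℝ≥0, ψ t '' (leafProj (nullDistribution g ι) '' A)
          = leafProj (nullDistribution g ι) '' A := by
  let N := nullDistribution g ι
  let π := leafProj N
  have hιs : ContMDiff (𝓡 (k + d)) (𝓡 (k + d + 1)) ∞ ι := hι.isImmersion.contMDiff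
  have hπs : ContMDiff (𝓡 (k + d)) (𝓡 d) ∞ π := hπ.contMDiff
  have hsurj : Function.Surjective π := Quotient.mk_surjective
  have : IsManifold (𝓡 d) 1 (LeafSpace N) := .of_le (n := ∞) (by simp)
  have hext (x : M) (v) (hv : v ∈ N x) := exists_isSection_nullDistribution g hιs hrank x hv
  have hconst (x y : M) (h : TangentCurveJoins N x y) : π x = π y :=
    Quotient.sound (Relation.EqvGen.rel _ _ h)
  -- Both vectors are compared in the model space, where the coordinates at `π x` and `π y` agree
  -- because the points do.
  have hbasic (x y : M) (h : π x = π y) :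
      (mfderiv (𝓡 (k + d)) (𝓡 d) π x (V x) : EuclideanSpace ℝ (Fin d)) =
        mfderiv (𝓡 (k + d)) (𝓡 d) π y (V y) := by
    have h' : Relation.EqvGen (TangentCurveJoins N) x y := Quotient.exact h
    clear h
    induction h' with
    | rel x y h => exact h.mfderiv_apply_eq hext hV hpres hπs hconst
    | refl x => rfl
    | symm x y _ ih => exact ih.symm
    | trans x y z _ _ h1 h2 => exact h1.trans h2
  let W : ∀ y : LeafSpace N, TangentSpace (𝓡 d) y := fun y ↦
    (mfderiv (𝓡 (k + d)) (𝓡 d) π (Function.surjInv hsurj y) (V (Function.surjInv hsurj y)) :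
      EuclideanSpace ℝ (Fin d))
  have hW (x : M) : mfderiv (𝓡 (k + d)) (𝓡 d) π x (V x) = W (π x) :=
    hbasic x _ (Function.surjInv_eq hsurj (π x)).symm
  have hWs : IsVectorField 2 W := by
    intro y
    obtain ⟨x, rfl⟩ := hsurj y
    obtain ⟨σ, hσ, hσx, hπσ⟩ := hπ.exists_contMDiffAt_section x
    have h1 : ContMDiff (𝓡 (k + d)).tangent (𝓡 d).tangent 2 (tangentMap (𝓡 (k + d)) (𝓡 d) π) :=
      hπs.contMDiff_tangentMap (WithTop.coe_le_coe.2 le_top)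
    have h2 := (h1.comp hV).contMDiffAt.comp (π x)
      (hσ.of_le (m := 2) (WithTop.coe_le_coe.2 le_top))
    refine h2.congr_of_eventuallyEq ?_
    filter_upwards [hπσ] with y hy
    have hy' : π (σ y) = y := hy
    simp only [Function.comp_apply, tangentMap]
    rw [hW, hy']
  have hπcurve {γ : ℝ → M} (hγ : IsMIntegralCurveOn γ V (Ici 0)) :
      IsMIntegralCurveOn (π ∘ γ) W (Ici 0) := by
    intro t ht
    have h1 := (hπs.mdifferentiableAt (by simp)).hasMFDerivAt.comp_hasMFDerivWithinAt t (hγ t ht)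
    refine h1.congr_mfderiv ?_
    refine ContinuousLinearMap.ext fun (s : ℝ) ↦ ?_
    exact (map_smul (mfderiv (𝓡 (k + d)) (𝓡 d) π (γ t)) s (V (γ t))).trans
      (congrArg (s • ·) (hW (γ t)))
  have hWs1 := hWs.of_le (m := 1) (by norm_num)
  have hunique {γ γ' : ℝ → LeafSpace N} (hγ : IsMIntegralCurveOn γ W (Ici 0))
      (hγ' : IsMIntegralCurveOn γ' W (Ici 0)) (h0 : γ 0 = γ' 0) : EqOn γ γ' (Ici 0) :=
    isMIntegralCurveOn_Ici_eqOn hWs1 hγ hγ' h0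
  have hdesc (t : ℝ≥0) (x y : M) (h : π x = π y) : π (φ t x) = π (φ t y) := by
    have := hunique (hπcurve (hφ x)) (hπcurve (hφ y)) (by simpa using h) t.2
    simpa using this
  let ψ₀ : ℝ≥0 → LeafSpace N → LeafSpace N := fun t y ↦ π (φ t (Function.surjInv hsurj y))
  have hψ₀ (t : ℝ≥0) (x : M) : ψ₀ t (π x) = π (φ t x) :=
    hdesc t _ _ (Function.surjInv_eq hsurj (π x))
  let ψ : Flow ℝ≥0 (LeafSpace N) :=
    { toFun := ψ₀
      cont' := by
        -- Openness of `π` ensures that the product with the identity is again a quotient map, so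
        -- joint continuity can be checked upstairs.
        have hq : IsOpenQuotientMap (Prod.map id π : ℝ≥0 × M → ℝ≥0 × LeafSpace N) :=
          IsOpenQuotientMap.id.prodMap ⟨hsurj, hπs.continuous, hπ.isOpenMap⟩
        rw [← hq.continuous_comp_iff]
        have : Function.uncurry ψ₀ ∘ Prod.map id π = fun p : ℝ≥0 × M ↦ π (φ p.1 p.2) :=
          funext fun p ↦ hψ₀ p.1 p.2
        rw [this]
        exact hπs.continuous.comp (φ.continuous continuous_fst continuous_snd)
      map_add' := by
        intro s t y
        obtain ⟨x, rfl⟩ := hsurj y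
        simp only [hψ₀, φ.map_add]
      map_zero' := by
        intro y
        obtain ⟨x, rfl⟩ := hsurj y
        simp only [hψ₀, φ.map_zero_apply] }
  have hψ (t : ℝ≥0) (x : M) : ψ t (π x) = π (φ t x) := hψ₀ t x
  have hψW : IsEvolutionOf ψ W := by
    intro y
    obtain ⟨x, rfl⟩ := hsurj y
    simp only [hψ]
    exact hπcurve (hφ x)
  refine ⟨hA.isCompact.image hπs.continuous, W, hWs, hW, fun W' hW' ↦ ?_, ψ, hψW,
    fun ψ' hψ' ↦ ?_, hψ, fun t ↦ ?_⟩
  · funext y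
    obtain ⟨x, rfl⟩ := hsurj y
    exact (hW' x).symm.trans (hW x)
  · ext t y
    have := hunique (hψ' y) (hψW y) (by simp) t.2
    simpa using this
  · conv_rhs => rw [← hA.invariant t]
    rw [image_image, image_image]
    exact image_congr fun x _ ↦ hψ t x
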